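/- Let $2\le k\le n$ be integers and let $0=n_0<n_1<\dots<n_{k-1}<n_k=n$ be integers; put $r_j=n_j-n_{j-1}$ for $j=1,\dots,k$. Let $U_{(1)}\le\dots\le U_{(n-1)}$ be the order statistics of $n-1$ independent random variables, each uniformly distributed on $(0,1)$, and put $U_{(0)}=0$, $U_{(n)}=1$ and $V_j=U_{(n_j)}-U_{(n_{j-1})}$ for $j=1,\dots,k$. For real $a<b$ and $p,q>0$ let $\widetilde{\mathrm{beta}}(p,q)$ denote the probability distribution on $[a,b]$ with density $$f_{p,q}(x)=\frac{(x-a)^{p-1}(b-x)^{q-1}}{B(p,q)\,(b-a)^{p+q-1}}\quad(a<x<b),\qquad f_{p,q}(x)=0\ \text{ otherwise},$$ where $B(p,q)=\Gamma(p)\Gamma(q)/\Gamma(p+q)$. Let $X_1,\dots,X_k$ be independent random variables, jointly independent of the uniform sample, such that $X_j$ has the $\widetilde{\mathrm{beta}}(r_j/2,r_j/2)$ distribution for each $j$ (with the same $a<b$). Then the randomly weighted average $$S_{n:n_1,\dots,n_{k-1}}=\sum_{j=1}^{k}V_jX_j$$ has the $\widetilde{\mathrm{beta}}\Bigl(\sum_{j=1}^{k}r_j/2,\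 \sum_{j=1}^{k}r_j/2\Bigr)$ distribution. -/

import Mathlib

open MeasureTheory ProbabilityTheory

namespace RWA

/-- The density of the beta distribution with parameters `p, q` over the interval `[a, b]`. -/
noncomputable def betaDensity (a b p q x : ℝ) : ℝ :=
  if a < x ∧ x < b then
    1 / (beta p q * (b - a) ^ (p + q - 1)) * (x - a) ^ (p - 1) * (b - x) ^ (q - 1)
  else 0

/-- The beta distribution with parameters `p, q` over the interval `[a, b]`, as a measure on `ℝ`. -/
noncomputable def betaLaw (a b p q : ℝ) : Measure ℝ :=
  volume.withDensity fun x => ENNReal.ofReal (betaDensity a b p q x)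

/-- The order statistics `U_(0), U_(1), …, U_(m), U_(m+1)` of a sample `u` of size `m`, with the
conventions `U_(0) = 0` and `U_(m+1) = 1`: for `1 ≤ i ≤ m`, `orderStat u i` is the `i`-th smallest
value of the sample. (Indices above `m + 1` are not used.) -/
noncomputable def orderStat {m : ℕ} (u : Fin m → ℝ) : ℕ → ℝ
  | 0 => 0
  | i + 1 => if h : i < m then u (Tuple.sort u ⟨i, h⟩) else 1

/-- The increments `r_j = n_j - n_{j-1}`, `j = 1, …, k`, of the selected indices
`n_0 < n_1 < ⋯ < n_k`. -/
def gap {k : ℕ} (N : Fin (k + 1) → ℕ) (j : Fin k) : ℕ :=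
  N j.succ - N j.castSucc

/-- The weights `V_j = U_(n_j) - U_(n_{j-1})`, `j = 1, …, k`. -/
noncomputable def weight {k m : ℕ} (N : Fin (k + 1) → ℕ) (u : Fin m → ℝ) (j : Fin k) : ℝ :=
  orderStat u (N j.succ) - orderStat u (N j.castSucc)

/-- The randomly weighted average `∑ j, V_j X_j`. -/
noncomputable def average {k m : ℕ} (N : Fin (k + 1) → ℕ) (u : Fin m → ℝ) (x : Fin k → ℝ) : ℝ :=
  ∑ j, weight N u j * x j

end RWA

/-! The proof is by moments, packaged as formal power series in `z`. An affine change of variable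
reduces to the interval `(0, 1)`. There, with the values `x j` fixed, the uniform law of the
spacings on the simplex gives `E (1 - z S)^(-n) = ∏ j, (1 - x j z)^(-r j)` coefficientwise
(`setIntegral_average_pow`, from the simplex integral `integral_orderedSet_spacingSum_pow`). A beta
variable `X` with parameters `p, q` satisfies `E (1 - z X)^(-(p + q)) = (1 - z)^(-p)`
(`coeff_mul_integral_pow_betaMeasure`). Taking `p = q = r j / 2` and using independence, the product
averages to `(1 - z)^(-n/2)`, which is the same transform of the beta law with parameters `n/2,
n/2`. The coefficients of `(1 - z)^(-n)` are nonzero, so all moments agree, and on a bounded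
interval the moments determine the law (`measure_ext_of_integral_pow`). -/

namespace RWA

/-! ### Formal powers of `1 - z` -/

/-- The power series of `(1 - z) ^ (-c)`. -/
noncomputable def negBinomialSeries (c : ℝ) : PowerSeries ℝ :=
  PowerSeries.rescale (-1) (PowerSeries.binomialSeries ℝ (-c))

lemma negBinomialSeries_zero : negBinomialSeries 0 = 1 := by
  simp [negBinomialSeries]

lemma negBinomialSeries_add (c d : ℝ) :
    negBinomialSeries (c + d) = negBinomialSeries c * negBinomialSeries d := by
  simp only [negBinomialSeries, neg_add, PowerSeries.binomialSeries_add, map_mul]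

lemma negBinomialSeries_sum {ι : Type*} (s : Finset ι) (c : ι → ℝ) :
    negBinomialSeries (∑ i ∈ s, c i) = ∏ i ∈ s, negBinomialSeries (c i) := by
  classical
  induction s using Finset.induction_on with
  | empty => simp [negBinomialSeries_zero]
  | insert a s ha ih => rw [Finset.sum_insert ha, Finset.prod_insert ha, negBinomialSeries_add, ih]

lemma coeff_negBinomialSeries {c : ℝ} (hc : 0 < c) (m : ℕ) :
    PowerSeries.coeff m (negBinomialSeries c) =
      Real.Gamma (c + m) / (Real.Gamma c * m.factorial) := by
  have hΓ := (Real.Gamma_pos_of_pos hc).ne'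
  simp only [negBinomialSeries, PowerSeries.coeff_rescale, PowerSeries.binomialSeries_coeff,
    smul_eq_mul, mul_one]
  induction m with
  | zero => simp [hΓ]
  | succ m ih =>
    have h := Ring.choose_smul_choose (-c) (Nat.le_succ m)
    rw [show m.succ - m = 1 by omega, Ring.choose_one_right] at h
    have hm : (m : ℝ) + 1 ≠ 0 := by positivity
    have e : ((m + 1).choose m : ℝ) = m + 1 := by simp
    rw [nsmul_eq_mul, e] at h
    have h3 : Real.Gamma (c + (m + 1 : ℕ)) = (c + m) * Real.Gamma (c + m) := by
      rw [← Real.Gamma_add_one (by positivity)]; push_cast; ring_nf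
    rw [h3, Nat.factorial_succ, pow_succ]
    have h4 : Ring.choose (-c) (m + 1) = Ring.choose (-c) m * (-c - m) / (m + 1) := by
      rw [eq_div_iff hm, ← h]; ring
    rw [h4]
    have h5 : (-1 : ℝ) ^ m * -1 * (Ring.choose (-c) m * (-c - m) / (m + 1)) =
      ((-1 : ℝ) ^ m * Ring.choose (-c) m) * (c + m) / (m + 1) := by ring
    rw [h5, ih]
    push_cast
    field_simp

lemma coeff_negBinomialSeries_pos {c : ℝ} (hc : 0 < c) (m : ℕ) :
    0 < PowerSeries.coeff m (negBinomialSeries c) := by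
  rw [coeff_negBinomialSeries hc]
  have := Real.Gamma_pos_of_pos hc
  have : 0 < Real.Gamma (c + m) := Real.Gamma_pos_of_pos (by positivity)
  positivity

lemma negBinomialSeries_one : negBinomialSeries 1 = PowerSeries.mk 1 := by
  ext m
  rw [coeff_negBinomialSeries one_pos, add_comm, Real.Gamma_nat_eq_factorial]
  simp [Nat.factorial_ne_zero]

lemma negBinomialSeries_natCast (r : ℕ) :
    negBinomialSeries r = (PowerSeries.mk 1) ^ r := by
  have := negBinomialSeries_sum (Finset.range r) (fun _ => 1)
  simpa [negBinomialSeries_one] using this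

/-- The power series of `(1 - x z)⁻¹`. -/
noncomputable def geomSeries (x : ℝ) : PowerSeries ℝ :=
  PowerSeries.mk fun i => x ^ i

lemma coeff_geomSeries_pow (x : ℝ) (r m : ℕ) :
    PowerSeries.coeff m (geomSeries x ^ r) =
      PowerSeries.coeff m (negBinomialSeries r) * x ^ m := by
  have : geomSeries x = PowerSeries.rescale x (PowerSeries.mk 1) := by
    ext i; simp [geomSeries, PowerSeries.coeff_rescale]
  rw [this, ← map_pow, ← negBinomialSeries_natCast, PowerSeries.coeff_rescale, mul_comm]

/-! ### Moments of the beta law -/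

lemma ae_betaMeasure_mem_Ioo (p q : ℝ) : ∀ᵐ x ∂betaMeasure p q, x ∈ Set.Ioo (0 : ℝ) 1 := by
  rw [betaMeasure, ae_withDensity_iff (by unfold betaPDF; fun_prop)]
  filter_upwards with x hx
  by_contra h
  apply hx
  rw [Set.mem_Ioo, not_and_or, not_lt, not_lt] at h
  exact h.elim betaPDF_eq_zero_of_nonpos betaPDF_eq_zero_of_one_le

lemma integral_betaPDFReal {p q : ℝ} (hp : 0 < p) (hq : 0 < q) :
    ∫ x, betaPDFReal p q x = 1 := by
  rw [integral_eq_lintegral_of_nonneg_ae]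
  · have := lintegral_betaPDF_eq_one hp hq
    unfold betaPDF at this
    rw [this]; simp
  · filter_upwards with x
    unfold betaPDFReal
    split_ifs with h
    · have := betaPDFReal_pos h.1 h.2 hp hq
      rw [betaPDFReal, if_pos h] at this
      exact this.le
    · exact le_rfl
  · fun_prop

lemma betaPDFReal_nonneg {p q : ℝ} (hp : 0 < p) (hq : 0 < q) (x : ℝ) : 0 ≤ betaPDFReal p q x := by
  by_cases h : 0 < x ∧ x < 1
  · exact (betaPDFReal_pos h.1 h.2 hp hq).le
  · rw [betaPDFReal, if_neg h]

lemma integral_pow_betaMeasure {p q : ℝ} (hp : 0 < p) (hq : 0 < q) (m : ℕ) :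
    ∫ x, x ^ m ∂betaMeasure p q = beta (p + m) q / beta p q := by
  rw [betaMeasure, integral_withDensity_eq_integral_toReal_smul (by unfold betaPDF; fun_prop)
    (by filter_upwards with x; simp [betaPDF])]
  have hpm : 0 < p + m := by positivity
  rw [← mul_one (_ / _), ← integral_betaPDFReal hpm hq, ← integral_const_mul]
  refine integral_congr_ae (Filter.Eventually.of_forall fun x => ?_)
  simp only [betaPDF, ENNReal.toReal_ofReal (betaPDFReal_nonneg hp hq x), smul_eq_mul]
  unfold betaPDFReal
  split_ifs with h
  · have h1 := (beta_pos hpm hq).ne'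
    have h2 := (beta_pos hp hq).ne'
    rw [show p + m - 1 = p - 1 + m by ring, Real.rpow_add h.1, Real.rpow_natCast]
    field_simp
  · simp

/-- Coefficient form of `E (1 - z X)^(-(p + q)) = (1 - z)^(-p)`: the factor `Γ(p + q + m)` of the
coefficient cancels the denominator of the moment. -/
lemma coeff_mul_integral_pow_betaMeasure {p q : ℝ} (hp : 0 < p) (hq : 0 < q) (m : ℕ) :
    PowerSeries.coeff m (negBinomialSeries (p + q)) * ∫ x, x ^ m ∂betaMeasure p q =
      PowerSeries.coeff m (negBinomialSeries p) := by
  rw [integral_pow_betaMeasure hp hq, coeff_negBinomialSeries hp,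
    coeff_negBinomialSeries (add_pos hp hq)]
  have h1 := (Real.Gamma_pos_of_pos hp).ne'
  have h2 := (Real.Gamma_pos_of_pos hq).ne'
  have h3 := (Real.Gamma_pos_of_pos (add_pos hp hq)).ne'
  have h4 : Real.Gamma (p + q + m) ≠ 0 := (Real.Gamma_pos_of_pos (by positivity)).ne'
  rw [beta, beta, show p + m + q = p + q + m by ring]
  field_simp

/-! ### Determinacy of moments on the unit interval -/

/-- Equal moments give equal integrals of polynomials, and by Weierstrass these approximate every
continuous function uniformly on `[0, 1]`, which carries both measures. -/
lemma measure_ext_of_integral_pow {μ ν : Measure ℝ} [IsProbabilityMeasure μ]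
    [IsProbabilityMeasure ν] (hμ : ∀ᵐ x ∂μ, x ∈ Set.Icc (0 : ℝ) 1)
    (hν : ∀ᵐ x ∂ν, x ∈ Set.Icc (0 : ℝ) 1) (h : ∀ m : ℕ, ∫ x, x ^ m ∂μ = ∫ x, x ^ m ∂ν) :
    μ = ν := by
  have hint : ∀ (ρ : Measure ℝ) [IsProbabilityMeasure ρ], (∀ᵐ x ∂ρ, x ∈ Set.Icc (0 : ℝ) 1) →
      ∀ m : ℕ, Integrable (fun x : ℝ => x ^ m) ρ := by
    intro ρ _ hρ m
    refine Integrable.of_bound (by fun_prop) 1 ?_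
    filter_upwards [hρ] with x hx
    rw [Real.norm_of_nonneg (pow_nonneg hx.1 m)]
    exact pow_le_one₀ hx.1 hx.2
  have hpi : ∀ (ρ : Measure ℝ) [IsProbabilityMeasure ρ], (∀ᵐ x ∂ρ, x ∈ Set.Icc (0 : ℝ) 1) →
      ∀ p : Polynomial ℝ, Integrable (fun x : ℝ => p.eval x) ρ := by
    intro ρ _ hρ p
    simp_rw [Polynomial.eval_eq_sum_range]
    exact integrable_finsetSum _ fun i _ => (hint ρ hρ i).const_mul _
  have hpoly : ∀ p : Polynomial ℝ, ∫ x, p.eval x ∂μ = ∫ x, p.eval x ∂ν := by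
    intro p
    simp_rw [Polynomial.eval_eq_sum_range]
    rw [integral_finsetSum _ fun i _ => (hint μ hμ i).const_mul _,
      integral_finsetSum _ fun i _ => (hint ν hν i).const_mul _]
    simp_rw [integral_const_mul, h]
  refine ext_of_forall_integral_eq_of_IsFiniteMeasure fun f => ?_
  have key : ∀ (ρ : Measure ℝ) [IsProbabilityMeasure ρ], (∀ᵐ x ∂ρ, x ∈ Set.Icc (0 : ℝ) 1) →
      ∀ (p : Polynomial ℝ) (ε : ℝ), (∀ x ∈ Set.Icc (0 : ℝ) 1, |p.eval x - f x| < ε) →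
      |∫ x, p.eval x ∂ρ - ∫ x, f x ∂ρ| ≤ ε := by
    intro ρ _ hρ p ε hp
    rw [← integral_sub (hpi ρ hρ p) (f.integrable ρ)]
    have hle : ∀ᵐ x ∂ρ, ‖p.eval x - f x‖ ≤ ε := by
      filter_upwards [hρ] with x hx using (hp x hx).le
    simpa using norm_integral_le_of_norm_le_const hle
  refine eq_of_forall_dist_le fun ε hε => ?_
  obtain ⟨p, hp⟩ := exists_polynomial_near_of_continuousOn 0 1 f f.continuous.continuousOn (ε / 2)
    (half_pos hε)
  have h1 := key μ hμ p _ hp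
  have h2 := key ν hν p _ hp
  rw [hpoly] at h1
  rw [Real.dist_eq]
  rw [abs_le] at *
  constructor <;> linarith [h1.1, h1.2, h2.1, h2.2]

/-! ### Splitting an index range into blocks -/

lemma prod_blocks {M : Type*} [CommMonoid M] {k : ℕ} (N : Fin (k + 1) → ℕ) (hN : Monotone N)
    (f : ℕ → M) :
    ∏ j : Fin k, ∏ i ∈ Finset.Ico (N j.castSucc) (N j.succ), f i =
      ∏ i ∈ Finset.Ico (N 0) (N (Fin.last k)), f i := by
  induction k with
  | zero => simp
  | succ k ih =>
    rw [Fin.prod_univ_castSucc]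
    have := ih (fun i => N i.castSucc) (fun i j h => hN (Fin.castSucc_le_castSucc_iff.2 h))
    simp only [Fin.castSucc_zero] at this
    simp only [Fin.succ_castSucc, Fin.succ_last]
    rw [this, Finset.prod_Ico_consecutive _ (hN (Fin.zero_le _)) (hN (Fin.le_last _))]

lemma sum_blocks {M : Type*} [AddCommMonoid M] {k : ℕ} (N : Fin (k + 1) → ℕ) (hN : Monotone N)
    (f : ℕ → M) :
    ∑ j : Fin k, ∑ i ∈ Finset.Ico (N j.castSucc) (N j.succ), f i =
      ∑ i ∈ Finset.Ico (N 0) (N (Fin.last k)), f i :=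
  prod_blocks (M := Multiplicative M) N hN f

/-- The function that takes the value `x j` on the block `[n_j, n_{j + 1})`. -/
noncomputable def blockFun {k : ℕ} (N : Fin (k + 1) → ℕ) (x : Fin k → ℝ) (i : ℕ) : ℝ :=
  ∑ j : Fin k, if i ∈ Finset.Ico (N j.castSucc) (N j.succ) then x j else 0

lemma blockFun_eq {k : ℕ} {N : Fin (k + 1) → ℕ} (hN : Monotone N) (x : Fin k → ℝ) {j : Fin k}
    {i : ℕ} (hi : i ∈ Finset.Ico (N j.castSucc) (N j.succ)) : blockFun N x i = x j := by
  rw [blockFun, Finset.sum_eq_single j, if_pos hi]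
  · intro l _ hl
    refine if_neg fun h => ?_
    rw [Finset.mem_Ico] at hi h
    rcases lt_or_gt_of_ne hl with hlt | hlt
    · have := hN (show l.succ ≤ j.castSucc from hlt)
      omega
    · have := hN (show j.succ ≤ l.castSucc from hlt)
      omega
  · simp

/-! ### Powers of linear forms integrated over the ordered simplex -/

/-- The sequence `0, u 0, …, u (m - 1), t, t, …`. -/
noncomputable def padded {m : ℕ} (u : Fin m → ℝ) (t : ℝ) : ℕ → ℝ
  | 0 => 0
  | i + 1 => if h : i < m then u ⟨i, h⟩ else t

/-- The sum of the increments of `padded u t` with the weights `y`. -/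
noncomputable def spacingSum {m : ℕ} (u : Fin m → ℝ) (t : ℝ) (y : ℕ → ℝ) : ℝ :=
  ∑ i ∈ Finset.range (m + 1), (padded u t (i + 1) - padded u t i) * y i

/-- The open simplex `0 < u 0 < ⋯ < u (m - 1) < t`. -/
def orderedSet (m : ℕ) (t : ℝ) : Set (Fin m → ℝ) :=
  {u | StrictMono u ∧ ∀ i, u i ∈ Set.Ioo 0 t}

lemma measurableSet_strictMono (m : ℕ) : MeasurableSet {u : Fin m → ℝ | StrictMono u} := by
  simp only [StrictMono, Set.ofPred_forall]
  exact MeasurableSet.iInter fun i => MeasurableSet.iInter fun j => MeasurableSet.iInter fun _ =>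
    measurableSet_lt (by fun_prop) (by fun_prop)

lemma measurableSet_orderedSet (m : ℕ) (t : ℝ) : MeasurableSet (orderedSet m t) := by
  have h : orderedSet m t =
      {u | StrictMono u} ∩ Set.univ.pi fun _ => Set.Ioo 0 t := by
    ext u; simp [orderedSet, Set.mem_pi]
  rw [h]
  exact (measurableSet_strictMono m).inter (MeasurableSet.univ_pi fun _ => measurableSet_Ioo)

lemma continuous_padded {m : ℕ} (t : ℝ) (i : ℕ) :
    Continuous fun u : Fin m → ℝ => padded u t i := by
  cases i with
  | zero => exact continuous_const
  | succ i =>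
    simp only [padded]
    split_ifs <;> fun_prop

lemma continuous_spacingSum {m : ℕ} (t : ℝ) (y : ℕ → ℝ) :
    Continuous fun u : Fin m → ℝ => spacingSum u t y :=
  continuous_finsetSum _ fun i _ =>
    ((continuous_padded t (i + 1)).sub (continuous_padded t i)).mul continuous_const

lemma integrable_indicator_orderedSet {m : ℕ} (t : ℝ) {f : (Fin m → ℝ) → ℝ} (hf : Continuous f) :
    Integrable ((orderedSet m t).indicator f) := by
  rw [integrable_indicator_iff (measurableSet_orderedSet m t)]
  refine (hf.continuousOn.integrableOn_compact
    (isCompact_Icc (a := (0 : Fin m → ℝ)) (b := fun _ => t))).mono_set fun u hu => ?_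
  exact ⟨fun i => (hu.2 i).1.le, fun i => (hu.2 i).2.le⟩

lemma padded_snoc_of_le {m : ℕ} (v : Fin m → ℝ) (s t : ℝ) {i : ℕ} (hi : i ≤ m + 1) :
    padded (Fin.snoc v s : Fin (m + 1) → ℝ) t i = padded v s i := by
  cases i with
  | zero => rfl
  | succ i =>
    have h : i < m + 1 := by omega
    simp only [padded, h, dite_true]
    by_cases h' : i < m
    · simp [Fin.snoc, h']
    · simp [Fin.snoc, h']

lemma spacingSum_snoc {m : ℕ} (v : Fin m → ℝ) (s t : ℝ) (y : ℕ → ℝ) :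
    spacingSum (Fin.snoc v s : Fin (m + 1) → ℝ) t y =
      spacingSum v s y + (t - s) * y (m + 1) := by
  rw [spacingSum, Finset.sum_range_succ, spacingSum]
  congr 1
  · refine Finset.sum_congr rfl fun i hi => ?_
    rw [Finset.mem_range] at hi
    rw [padded_snoc_of_le _ _ _ (by omega), padded_snoc_of_le _ _ _ (by omega)]
  · rw [padded_snoc_of_le _ _ _ le_rfl]
    simp [padded]

lemma snoc_mem_orderedSet {m : ℕ} {v : Fin m → ℝ} {s t : ℝ} :
    (Fin.snoc v s : Fin (m + 1) → ℝ) ∈ orderedSet (m + 1) t ↔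
      s ∈ Set.Ioo 0 t ∧ v ∈ orderedSet m s := by
  constructor
  · rintro ⟨h1, h2⟩
    have hs := h2 (Fin.last m)
    rw [Fin.snoc_last] at hs
    refine ⟨hs, fun i j hij => ?_, fun i => ⟨?_, ?_⟩⟩
    · have := h1 (Fin.castSucc_lt_castSucc_iff.2 hij)
      simpa using this
    · simpa using (h2 i.castSucc).1
    · simpa using h1 (Fin.castSucc_lt_last i)
  · rintro ⟨hs, h1, h2⟩
    refine ⟨fun i j => ?_, fun i => ?_⟩
    · refine Fin.lastCases ?_ (fun j => ?_) j
      · refine Fin.lastCases (fun h => absurd h (lt_irrefl _)) (fun i _ => ?_) i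
        simpa using (h2 i).2
      · refine Fin.lastCases (fun h => absurd h (Fin.castSucc_lt_last j).not_gt) (fun i h => ?_) i
        simpa using h1 (Fin.castSucc_lt_castSucc_iff.1 h)
    · refine Fin.lastCases ?_ (fun i => ?_) i
      · simpa using hs
      · simpa using ⟨(h2 i).1, (h2 i).2.trans hs.2⟩

lemma integral_pow_mul_sub_pow {t : ℝ} (ht : 0 < t) (p q : ℕ) :
    ∫ s in (0 : ℝ)..t, s ^ p * (t - s) ^ q =
      p.factorial * q.factorial / (p + q + 1).factorial * t ^ (p + q + 1) := by
  have h := Complex.betaIntegral_scaled (p + 1) (q + 1) ht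
  rw [Complex.betaIntegral_eq_Gamma_mul_div (p + 1) (q + 1)
    (by simp; positivity) (by simp; positivity),
    show (p : ℂ) + 1 + (q + 1) - 1 = (p + q + 1 : ℕ) by push_cast; ring,
    show (p : ℂ) + 1 + (q + 1) = (p + q + 1 : ℕ) + 1 by push_cast; ring] at h
  simp only [add_sub_cancel_right, Complex.cpow_natCast, Complex.Gamma_nat_eq_factorial] at h
  have h' : ((∫ s in (0 : ℝ)..t, s ^ p * (t - s) ^ q : ℝ) : ℂ) =
      (p.factorial * q.factorial / (p + q + 1).factorial * t ^ (p + q + 1) : ℝ) := by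
    rw [← intervalIntegral.integral_ofReal]
    push_cast at h ⊢
    rw [h]; ring
  exact_mod_cast h'

lemma integral_eq_integral_integral_snoc {m : ℕ} {f : (Fin (m + 1) → ℝ) → ℝ} (hf : Integrable f) :
    ∫ u, f u = ∫ s : ℝ, ∫ v : Fin m → ℝ, f (Fin.snoc v s) := by
  have mp := (volume_preserving_piFinSuccAbove (fun _ : Fin (m + 1) => ℝ) (Fin.last m)).symm
  rw [← mp.integral_comp (MeasurableEquiv.measurableEmbedding _) f, Measure.volume_eq_prod,
    integral_prod]
  · simp [MeasurableEquiv.piFinSuccAbove, Fin.insertNthEquiv]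
  · exact (mp.integrable_comp_emb (MeasurableEquiv.measurableEmbedding _)).2 hf

/-- The coefficient is the complete homogeneous symmetric polynomial of degree `M` in `y 0, …, y m`.
The induction slices the simplex by its largest coordinate `s`; the slice is the simplex of size `s`
in one dimension less, so `t` has to vary. -/
lemma integral_orderedSet_spacingSum_pow (y : ℕ → ℝ) (m M : ℕ) {t : ℝ} (ht : 0 < t) :
    ∫ u : Fin m → ℝ, (orderedSet m t).indicator (fun u => spacingSum u t y ^ M) u =
      M.factorial * t ^ (m + M) / (m + M).factorial *
        PowerSeries.coeff M (∏ i ∈ Finset.range (m + 1), geomSeries (y i)) := by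
  induction m generalizing M t with
  | zero =>
    have h0 : orderedSet 0 t = Set.univ := by
      ext u; simp [orderedSet, Subsingleton.strictMono]
    have hM := Nat.factorial_ne_zero M
    rw [h0, Set.indicator_univ, volume_pi, Measure.pi_of_empty, integral_dirac]
    simp only [spacingSum, padded, geomSeries, zero_add, Finset.range_one, Finset.sum_singleton,
      lt_irrefl, dite_false, sub_zero, Finset.prod_singleton, PowerSeries.coeff_mk, mul_pow]
    field_simp
  | succ m ih =>
    rw [integral_eq_integral_integral_snoc (f := (orderedSet (m + 1) t).indicator _)
      (integrable_indicator_orderedSet t ((continuous_spacingSum t y).fun_pow M))]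
    set c : ℕ → ℝ := fun j =>
      PowerSeries.coeff j (∏ i ∈ Finset.range (m + 1), geomSeries (y i)) with hc
    have inner : ∀ s ∈ Set.Ioo 0 t, (∫ v : Fin m → ℝ, (orderedSet (m + 1) t).indicator
        (fun u => spacingSum u t y ^ M) (Fin.snoc v s)) =
        ∑ j ∈ Finset.range (M + 1), (M.choose j * y (m + 1) ^ (M - j) *
          (j.factorial / (m + j).factorial) * c j) * (s ^ (m + j) * (t - s) ^ (M - j)) := by
      intro s hs
      -- On a slice the form is the lower-dimensional one plus the last spacing `(t - s) * y (m +
      -- 1)`; the binomial theorem separates them.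
      have e : ∀ v : Fin m → ℝ, (orderedSet (m + 1) t).indicator
          (fun u => spacingSum u t y ^ M) (Fin.snoc v s) =
          ∑ j ∈ Finset.range (M + 1), (M.choose j * ((t - s) * y (m + 1)) ^ (M - j)) *
            (orderedSet m s).indicator (fun u => spacingSum u s y ^ j) v := by
        intro v
        by_cases hv : v ∈ orderedSet m s
        · rw [Set.indicator_of_mem (snoc_mem_orderedSet.2 ⟨hs, hv⟩), spacingSum_snoc, add_pow]
          refine Finset.sum_congr rfl fun j _ => ?_
          rw [Set.indicator_of_mem hv]
          ring
        · rw [Set.indicator_of_notMem fun h => hv (snoc_mem_orderedSet.1 h).2]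
          simp [Set.indicator_of_notMem hv]
      simp_rw [e]
      rw [integral_finsetSum _ fun j _ => (integrable_indicator_orderedSet s
        ((continuous_spacingSum s y).fun_pow j)).const_mul _]
      refine Finset.sum_congr rfl fun j _ => ?_
      rw [integral_const_mul, ih j hs.1, mul_pow]
      ring
    have outer : (fun s : ℝ => ∫ v : Fin m → ℝ, (orderedSet (m + 1) t).indicator
        (fun u => spacingSum u t y ^ M) (Fin.snoc v s)) = (Set.Ioo 0 t).indicator fun s =>
        ∑ j ∈ Finset.range (M + 1), (M.choose j * y (m + 1) ^ (M - j) *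
          (j.factorial / (m + j).factorial) * c j) * (s ^ (m + j) * (t - s) ^ (M - j)) := by
      ext s
      by_cases hs : s ∈ Set.Ioo 0 t
      · rw [inner s hs, Set.indicator_of_mem hs]
      · rw [Set.indicator_of_notMem hs]
        refine integral_eq_zero_of_ae (Filter.Eventually.of_forall fun v => ?_)
        exact Set.indicator_of_notMem (fun h => hs (snoc_mem_orderedSet.1 h).1) _
    rw [outer, integral_indicator measurableSet_Ioo, ← integral_Ioc_eq_integral_Ioo,
      ← intervalIntegral.integral_of_le ht.le, intervalIntegral.integral_finsetSum
        fun j _ => Continuous.intervalIntegrable (by fun_prop) _ _]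
    rw [Finset.prod_range_succ, PowerSeries.coeff_mul, Finset.Nat.sum_antidiagonal_eq_sum_range_succ
      (fun i j => PowerSeries.coeff i (∏ i ∈ Finset.range (m + 1), geomSeries (y i)) *
        PowerSeries.coeff j (geomSeries (y (m + 1)))), Finset.mul_sum]
    refine Finset.sum_congr rfl fun j hj => ?_
    have hjM : j ≤ M := by rw [Finset.mem_range] at hj; omega
    -- The binomial coefficient, the induction constant and the beta integral combine to `M! / (m +
    -- 1 + M)!`, free of `j`; what remains is the Cauchy product with the last geometric series.
    rw [intervalIntegral.integral_const_mul, integral_pow_mul_sub_pow ht,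
      show m + j + (M - j) + 1 = m + 1 + M by omega, geomSeries, PowerSeries.coeff_mk,
      Nat.cast_choose ℝ hjM]
    simp only [hc, geomSeries]
    have f1 := Nat.factorial_ne_zero j
    have f2 := Nat.factorial_ne_zero (M - j)
    have f3 := Nat.factorial_ne_zero (m + j)
    have f4 := Nat.factorial_ne_zero (m + 1 + M)
    field_simp

/-! ### From the simplex to order statistics -/

lemma ae_injective (m : ℕ) : ∀ᵐ u : Fin m → ℝ, Function.Injective u := by
  have h : ∀ i j : Fin m, i ≠ j → ∀ᵐ u : Fin m → ℝ, u i ≠ u j := by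
    intro i j hij
    -- The ties `u i = u j` form a proper subspace, hence a null set.
    let S : Submodule ℝ (Fin m → ℝ) :=
      LinearMap.ker ((LinearMap.proj i : (Fin m → ℝ) →ₗ[ℝ] ℝ) - LinearMap.proj j)
    have hS : S ≠ ⊤ := by
      intro hS
      have : Pi.single i (1 : ℝ) ∈ S := hS ▸ Submodule.mem_top
      simp [S, Pi.single_eq_of_ne hij.symm] at this
    rw [ae_iff]
    refine measure_mono_null (fun u hu => ?_) (Measure.addHaar_submodule volume S hS)
    simpa [S, sub_eq_zero] using hu
  have h' : ∀ᵐ u : Fin m → ℝ, ∀ i j : Fin m, i ≠ j → u i ≠ u j := by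
    simp only [ae_all_iff]
    exact h
  filter_upwards [h'] with u hu i j hij
  by_contra hne
  exact hu i j hne hij

lemma volume_preserving_comp_perm {m : ℕ} (σ : Equiv.Perm (Fin m)) :
    MeasurePreserving (fun u : Fin m → ℝ => u ∘ σ) := by
  convert! volume_measurePreserving_piCongrLeft (fun _ : Fin m => ℝ) σ.symm using 1
  ext u i
  have := MeasurableEquiv.piCongrLeft_apply_apply σ.symm (β := fun _ => ℝ) u (σ i)
  simpa using this.symm

lemma measurableEmbedding_comp_perm {m : ℕ} (σ : Equiv.Perm (Fin m)) :
    MeasurableEmbedding (fun u : Fin m → ℝ => u ∘ σ) := by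
  convert! (MeasurableEquiv.piCongrLeft (fun _ : Fin m => ℝ) σ.symm).measurableEmbedding using 1
  ext u i
  have := MeasurableEquiv.piCongrLeft_apply_apply σ.symm (β := fun _ => ℝ) u (σ i)
  simpa using this.symm

lemma comp_perm_mem_orderedSet {m : ℕ} {u : Fin m → ℝ} (hu : Function.Injective u)
    (σ : Equiv.Perm (Fin m)) (t : ℝ) :
    u ∘ σ ∈ orderedSet m t ↔ (u ∈ Set.univ.pi fun _ => Set.Ioo 0 t) ∧ σ = Tuple.sort u := by
  have h1 : StrictMono (u ∘ σ) ↔ σ = Tuple.sort u := by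
    constructor
    · intro h
      have := Tuple.comp_sort_eq_comp_iff_monotone.2 h.monotone
      ext i
      exact congrArg Fin.val (hu (congrFun this i))
    · rintro rfl
      exact (Tuple.monotone_sort u).strictMono_of_injective
        (hu.comp (Equiv.injective _))
  have h2 : (∀ i, (u ∘ σ) i ∈ Set.Ioo 0 t) ↔ u ∈ Set.univ.pi fun _ => Set.Ioo 0 t := by
    rw [Set.mem_univ_pi]
    exact ⟨fun h i => by simpa using h (σ.symm i), fun h i => h _⟩
  rw [orderedSet, Set.mem_ofPred_eq, h1, h2, and_comm]

/-- Up to ties, the cube is the disjoint union of `m!` permuted copies of the simplex, and permuting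
coordinates preserves volume. -/
lemma setIntegral_comp_sort {m : ℕ} (t : ℝ) {g : (Fin m → ℝ) → ℝ} (hg : Continuous g) :
    ∫ u in Set.univ.pi fun _ : Fin m => Set.Ioo 0 t, g (u ∘ Tuple.sort u) =
      m.factorial * ∫ u, (orderedSet m t).indicator g u := by
  rw [← integral_indicator (MeasurableSet.univ_pi fun _ => measurableSet_Ioo)]
  have e : (Set.univ.pi fun _ : Fin m => Set.Ioo 0 t).indicator
      (fun u => g (u ∘ Tuple.sort u)) =ᵐ[volume]
      fun u => ∑ σ : Equiv.Perm (Fin m), (orderedSet m t).indicator g (u ∘ σ) := by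
    filter_upwards [ae_injective m] with u hu
    rw [Finset.sum_eq_single (Tuple.sort u)]
    · by_cases h : u ∈ Set.univ.pi fun _ : Fin m => Set.Ioo 0 t
      · rw [Set.indicator_of_mem h,
          Set.indicator_of_mem ((comp_perm_mem_orderedSet hu _ t).2 ⟨h, rfl⟩)]
      · rw [Set.indicator_of_notMem h,
          Set.indicator_of_notMem fun h' => h ((comp_perm_mem_orderedSet hu _ t).1 h').1]
    · intro σ _ hσ
      exact Set.indicator_of_notMem (fun h' => hσ ((comp_perm_mem_orderedSet hu _ t).1 h').2) _
    · simp
  have hi := integrable_indicator_orderedSet t hg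
  rw [integral_congr_ae e, integral_finsetSum]
  · simp_rw [fun σ => (volume_preserving_comp_perm σ).integral_comp
      (measurableEmbedding_comp_perm σ) ((orderedSet m t).indicator g)]
    simp [Fintype.card_perm]
  · intro σ _
    exact ((volume_preserving_comp_perm σ).integrable_comp_emb
      (measurableEmbedding_comp_perm σ)).2 hi

lemma orderStat_eq_padded {m : ℕ} (u : Fin m → ℝ) : orderStat u = padded (u ∘ Tuple.sort u) 1 := by
  ext i
  cases i <;> rfl

/-- Each of the finitely many sorting permutations is selected on a measurable set, and on that set
the order statistic is a constant or a coordinate. -/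
lemma measurable_orderStat {m : ℕ} (i : ℕ) : Measurable fun u : Fin m → ℝ => orderStat u i := by
  classical
  have hs : ∀ σ : Equiv.Perm (Fin m), MeasurableSet {u : Fin m → ℝ | σ = Tuple.sort u} := by
    intro σ
    have h : {u : Fin m → ℝ | σ = Tuple.sort u} = {u | Monotone (u ∘ σ)} ∩
        {u | ∀ i j, i < j → u (σ i) = u (σ j) → σ i < σ j} := by
      ext u
      exact Tuple.eq_sort_iff
    rw [h]
    refine MeasurableSet.inter ?_ ?_
    · simp only [Monotone, Set.ofPred_forall]
      exact MeasurableSet.iInter fun i => MeasurableSet.iInter fun j => MeasurableSet.iInter fun _ =>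
        measurableSet_le (by fun_prop) (by fun_prop)
    · simp only [Set.ofPred_forall]
      refine MeasurableSet.iInter fun i => MeasurableSet.iInter fun j =>
        MeasurableSet.iInter fun _ => ?_
      by_cases h : σ i < σ j
      · simp [h]
      · simp only [h, imp_false]
        exact (measurableSet_eq_fun (by fun_prop) (by fun_prop)).compl
  have e : (fun u : Fin m → ℝ => orderStat u i) = fun u => ∑ σ : Equiv.Perm (Fin m),
      if σ = Tuple.sort u then padded (u ∘ σ) 1 i else 0 := by
    ext u
    simp [orderStat_eq_padded]
  rw [e]
  refine Finset.measurable_sum _ fun σ _ => Measurable.ite (hs σ) ?_ measurable_const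
  exact (continuous_padded 1 i).measurable.comp (measurable_pi_lambda _ fun j => by fun_prop)

lemma orderStat_le_succ {m : ℕ} {u : Fin m → ℝ} (hu : ∀ i, u i ∈ Set.Ioo (0 : ℝ) 1) {i : ℕ} :
    orderStat u i ≤ orderStat u (i + 1) := by
  rw [orderStat_eq_padded]
  cases i with
  | zero =>
    simp only [padded]
    split_ifs with h
    · exact (hu _).1.le
    · exact zero_le_one
  | succ i =>
    simp only [padded]
    split_ifs with h1 h2 h2
    · exact Tuple.monotone_sort u (Fin.mk_le_mk.2 i.le_succ)
    · exact (hu _).2.le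
    · omega
    · exact le_rfl

/-! ### Weights and conditional moments of the average -/

lemma weight_nonneg {k m : ℕ} {N : Fin (k + 1) → ℕ} (hN : Monotone N) {u : Fin m → ℝ}
    (hu : ∀ i, u i ∈ Set.Ioo (0 : ℝ) 1) (j : Fin k) : 0 ≤ weight N u j :=
  sub_nonneg.2 (monotone_nat_of_le_succ (f := orderStat u) (fun _ => orderStat_le_succ hu)
    (hN (Fin.castSucc_le_succ j)))

lemma sum_weight {k m : ℕ} {N : Fin (k + 1) → ℕ} (hN : Monotone N) (hN0 : N 0 = 0)
    (hNk : N (Fin.last k) = m + 1) (u : Fin m → ℝ) : ∑ j, weight N u j = 1 := by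
  have h : ∀ j, weight N u j = ∑ i ∈ Finset.Ico (N j.castSucc) (N j.succ),
      (orderStat u (i + 1) - orderStat u i) := fun j => by
    rw [Finset.sum_Ico_sub _ (hN (Fin.castSucc_le_succ j)), weight]
  simp_rw [h]
  rw [sum_blocks N hN, hN0, hNk, Finset.sum_Ico_sub _ (Nat.zero_le _)]
  simp [orderStat]

lemma average_eq_spacingSum {k m : ℕ} {N : Fin (k + 1) → ℕ} (hN : Monotone N) (hN0 : N 0 = 0)
    (hNk : N (Fin.last k) = m + 1) (u : Fin m → ℝ) (x : Fin k → ℝ) :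
    average N u x = spacingSum (u ∘ Tuple.sort u) 1 (blockFun N x) := by
  have h : ∀ j, weight N u j * x j = ∑ i ∈ Finset.Ico (N j.castSucc) (N j.succ),
      (orderStat u (i + 1) - orderStat u i) * blockFun N x i := fun j => by
    rw [weight, ← Finset.sum_Ico_sub _ (hN (Fin.castSucc_le_succ j)), Finset.sum_mul]
    exact Finset.sum_congr rfl fun i hi => by rw [blockFun_eq hN x hi]
  simp_rw [average, h]
  rw [sum_blocks N hN, hN0, hNk, spacingSum, orderStat_eq_padded, Finset.range_eq_Ico]

lemma prod_geomSeries_blockFun {k m : ℕ} {N : Fin (k + 1) → ℕ} (hN : Monotone N) (hN0 : N 0 = 0)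
    (hNk : N (Fin.last k) = m + 1) (x : Fin k → ℝ) :
    ∏ i ∈ Finset.range (m + 1), geomSeries (blockFun N x i) =
      ∏ j, geomSeries (x j) ^ gap N j := by
  rw [Finset.range_eq_Ico, ← hN0, ← hNk, ← prod_blocks N hN]
  refine Finset.prod_congr rfl fun j _ => ?_
  rw [Finset.prod_congr rfl fun i hi => by rw [blockFun_eq hN x hi]]
  simp [gap]

lemma sum_gap {k m : ℕ} {N : Fin (k + 1) → ℕ} (hN : Monotone N) (hN0 : N 0 = 0)
    (hNk : N (Fin.last k) = m) : ∑ j, gap N j = m := by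
  have := sum_blocks N hN fun _ => 1
  simpa [hN0, hNk, gap] using this

/-- The moments of the randomly weighted average, conditionally on the averaged variables. -/
lemma setIntegral_average_pow {k m : ℕ} {N : Fin (k + 1) → ℕ} (hN : Monotone N) (hN0 : N 0 = 0)
    (hNk : N (Fin.last k) = m + 1) (x : Fin k → ℝ) (M : ℕ) :
    PowerSeries.coeff M (negBinomialSeries (m + 1 : ℕ)) *
      ∫ u in Set.univ.pi fun _ : Fin m => Set.Ioo 0 1, average N u x ^ M =
      PowerSeries.coeff M (∏ j, geomSeries (x j) ^ gap N j) := by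
  simp_rw [average_eq_spacingSum hN hN0 hNk]
  rw [setIntegral_comp_sort 1 (g := fun u => spacingSum u 1 (blockFun N x) ^ M)
    ((continuous_spacingSum 1 _).fun_pow M), integral_orderedSet_spacingSum_pow _ _ _ one_pos,
    prod_geomSeries_blockFun hN hN0 hNk, coeff_negBinomialSeries (by positivity),
    show ((m + 1 : ℕ) : ℝ) + M = (m + M : ℕ) + 1 by push_cast; ring, Real.Gamma_nat_eq_factorial,
    Nat.cast_succ, Real.Gamma_nat_eq_factorial]
  have f1 := Nat.factorial_ne_zero M
  have f2 := Nat.factorial_ne_zero m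
  have f3 := Nat.factorial_ne_zero (m + M)
  field_simp
  simp

/-! ### Affine reduction to the unit interval -/

lemma map_affine_betaMeasure {a b : ℝ} (hab : a < b) (p q : ℝ) :
    (betaMeasure p q).map (fun x => a + (b - a) * x) = betaLaw a b p q := by
  have hc : 0 < b - a := sub_pos.2 hab
  -- The Jacobian factor `b - a` here later cancels the scaling of Lebesgue measure in `hvol`.
  have hdens : ∀ x, betaPDF p q x =
      ENNReal.ofReal (b - a) * ENNReal.ofReal (betaDensity a b p q (a + (b - a) * x)) := by
    intro x
    rw [← ENNReal.ofReal_mul hc.le, betaPDF, betaPDFReal, betaDensity]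
    congr 1
    have h1 : a < a + (b - a) * x ↔ 0 < x := by
      rw [lt_add_iff_pos_right, mul_pos_iff_of_pos_left hc]
    have h2 : a + (b - a) * x < b ↔ x < 1 := by
      rw [← lt_sub_iff_add_lt', mul_lt_iff_lt_one_right hc]
    simp only [h1, h2]
    split_ifs with h
    · have h3 : b - (a + (b - a) * x) = (b - a) * (1 - x) := by ring
      rw [h3, add_sub_cancel_left, Real.mul_rpow hc.le h.1.le,
        Real.mul_rpow hc.le (sub_pos.2 h.2).le,
        show p + q - 1 = (p - 1) + (q - 1) + 1 by ring, Real.rpow_add_one hc.ne',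
        Real.rpow_add hc]
      have h4 := (Real.rpow_pos_of_pos hc (p - 1)).ne'
      have h5 := (Real.rpow_pos_of_pos hc (q - 1)).ne'
      field_simp
    · simp
  have hmeas : Measurable fun y => ENNReal.ofReal (betaDensity a b p q y) :=
    (Measurable.ite measurableSet_Ioo (by fun_prop) (by fun_prop)).ennreal_ofReal
  have hvol : (volume : Measure ℝ).map (fun x => a + (b - a) * x) =
      ENNReal.ofReal (b - a)⁻¹ • volume := by
    have : (fun x => a + (b - a) * x) = (fun x => a + x) ∘ fun x => (b - a) * x := rfl
    rw [this, ← Measure.map_map (by fun_prop) (by fun_prop), Real.map_volume_mul_left hc.ne',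
      Measure.map_smul, map_add_left_eq_self, abs_of_pos (inv_pos.2 hc)]
  ext s hs
  have hT : Measurable fun x : ℝ => a + (b - a) * x := by fun_prop
  rw [Measure.map_apply hT hs, betaMeasure, betaLaw, withDensity_apply _ (hT hs),
    withDensity_apply _ hs]
  simp_rw [hdens]
  rw [lintegral_const_mul' _ _ ENNReal.ofReal_ne_top, ← setLIntegral_map hs hmeas hT, hvol,
    Measure.restrict_smul, lintegral_smul_measure, smul_eq_mul, ← mul_assoc,
    ← ENNReal.ofReal_mul hc.le, mul_inv_cancel₀ hc.ne', ENNReal.ofReal_one, one_mul]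

lemma hasLaw_betaMeasure_of_betaLaw {Ω : Type*} [MeasurableSpace Ω] {P : Measure Ω} {a b p q : ℝ}
    (hab : a < b) {X : Ω → ℝ} (hX : HasLaw X (betaLaw a b p q) P) :
    HasLaw (fun ω => (X ω - a) / (b - a)) (betaMeasure p q) P := by
  refine HasLaw.fun_comp (Y := fun x => (x - a) / (b - a)) ⟨by fun_prop, ?_⟩ hX
  rw [← map_affine_betaMeasure hab, Measure.map_map (by fun_prop) (by fun_prop)]
  convert! Measure.map_id
  ext x
  have := (sub_pos.2 hab).ne'
  simp only [Function.comp_apply, id]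
  field_simp
  ring

lemma average_mem_Icc {k m : ℕ} {N : Fin (k + 1) → ℕ} (hN : Monotone N) (hN0 : N 0 = 0)
    (hNk : N (Fin.last k) = m + 1) {u : Fin m → ℝ} (hu : ∀ i, u i ∈ Set.Ioo (0 : ℝ) 1)
    {x : Fin k → ℝ} (hx : ∀ j, x j ∈ Set.Ioo (0 : ℝ) 1) : average N u x ∈ Set.Icc (0 : ℝ) 1 := by
  refine ⟨Finset.sum_nonneg fun j _ => mul_nonneg (weight_nonneg hN hu j) (hx j).1.le, ?_⟩
  rw [← sum_weight hN hN0 hNk u]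
  exact Finset.sum_le_sum fun j _ => mul_le_of_le_one_right (weight_nonneg hN hu j) (hx j).2.le

lemma measurable_average {k m : ℕ} (N : Fin (k + 1) → ℕ) :
    Measurable fun z : (Fin k → ℝ) × (Fin m → ℝ) => average N z.2 z.1 :=
  Finset.measurable_sum _ fun j _ => Measurable.mul
    (((measurable_orderStat _).comp measurable_snd).sub
      ((measurable_orderStat _).comp measurable_snd))
    ((measurable_pi_apply j).comp measurable_fst)

lemma average_affine {k m : ℕ} {N : Fin (k + 1) → ℕ} (hN : Monotone N) (hN0 : N 0 = 0)
    (hNk : N (Fin.last k) = m + 1) (u : Fin m → ℝ) (x : Fin k → ℝ) (a c : ℝ) :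
    average N u (fun j => a + c * x j) = a + c * average N u x := by
  calc average N u (fun j => a + c * x j)
      = a * (∑ j, weight N u j) + c * average N u x := by
        simp only [average, Finset.mul_sum, ← Finset.sum_add_distrib]
        exact Finset.sum_congr rfl fun j _ => by ring
    _ = a + c * average N u x := by rw [sum_weight hN hN0 hNk, mul_one]

instance isProbabilityMeasure_restrict_Ioo :
    IsProbabilityMeasure ((volume : Measure ℝ).restrict (Set.Ioo 0 1)) := ⟨by simp⟩

/-! ### Averaging over the beta variables and matching moments -/

/-- A fixed coefficient is a finite sum of products of one-variable monomials, so independence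
factors each integral. The exponent `r j` equals the parameter sum `r j / 2 + r j / 2`, exactly what
the beta moment identity requires. -/
lemma integral_coeff_prod_geomSeries {k : ℕ} {r : Fin k → ℕ} (hr : ∀ j, 0 < r j) (M : ℕ) :
    ∫ x, PowerSeries.coeff M (∏ j, geomSeries (x j) ^ r j)
      ∂Measure.pi (fun j => betaMeasure ((r j : ℝ) / 2) ((r j : ℝ) / 2)) =
      PowerSeries.coeff M (negBinomialSeries (∑ j, (r j : ℝ) / 2)) := by
  have hr' : ∀ j, (0 : ℝ) < r j / 2 := fun j => half_pos (Nat.cast_pos.2 (hr j))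
  have hprob : ∀ j, IsProbabilityMeasure (betaMeasure ((r j : ℝ) / 2) ((r j : ℝ) / 2)) :=
    fun j => isProbabilityMeasureBeta (hr' j) (hr' j)
  simp_rw [PowerSeries.coeff_prod, coeff_geomSeries_pow]
  rw [integral_finsetSum, negBinomialSeries_sum, PowerSeries.coeff_prod]
  · refine Finset.sum_congr rfl fun l _ => ?_
    rw [integral_fintype_prod_eq_prod (f := fun j x =>
      PowerSeries.coeff (l j) (negBinomialSeries (r j)) * x ^ l j)]
    refine Finset.prod_congr rfl fun j _ => ?_
    rw [integral_const_mul, ← coeff_mul_integral_pow_betaMeasure (hr' j) (hr' j), add_halves]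
  · intro l _
    refine Integrable.fintype_prod (f := fun j x =>
      PowerSeries.coeff (l j) (negBinomialSeries (r j)) * x ^ l j) fun j => ?_
    refine Integrable.const_mul (Integrable.of_bound (by fun_prop) 1 ?_) _
    filter_upwards [ae_betaMeasure_mem_Ioo _ _] with x hx
    rw [Real.norm_of_nonneg (pow_nonneg hx.1.le _)]
    exact pow_le_one₀ hx.1.le hx.2.le

/-- The law of the randomly weighted average of independent symmetric beta variables on `(0, 1)`. -/
lemma hasLaw_average_prod {k m : ℕ} {N : Fin (k + 1) → ℕ} (hN : StrictMono N) (hN0 : N 0 = 0)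
    (hNk : N (Fin.last k) = m + 1) :
    HasLaw (fun z : (Fin k → ℝ) × (Fin m → ℝ) => average N z.2 z.1)
      (betaMeasure (∑ j, (gap N j : ℝ) / 2) (∑ j, (gap N j : ℝ) / 2))
      ((Measure.pi fun j => betaMeasure ((gap N j : ℝ) / 2) ((gap N j : ℝ) / 2)).prod
        (Measure.pi fun _ => volume.restrict (Set.Ioo 0 1))) := by
  have hgap : ∀ j, 0 < gap N j := fun j => Nat.sub_pos_of_lt (hN Fin.castSucc_lt_succ)
  have hr' : ∀ j, (0 : ℝ) < gap N j / 2 := fun j => half_pos (Nat.cast_pos.2 (hgap j))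
  have hsum : ∑ j, (gap N j : ℝ) / 2 = (m + 1 : ℕ) / 2 := by
    rw [← Finset.sum_div, ← sum_gap hN.monotone hN0 hNk]
    push_cast
    rfl
  have hpos : 0 < ∑ j, (gap N j : ℝ) / 2 := by rw [hsum]; positivity
  have hprob : ∀ j, IsProbabilityMeasure (betaMeasure ((gap N j : ℝ) / 2) ((gap N j : ℝ) / 2)) :=
    fun j => isProbabilityMeasureBeta (hr' j) (hr' j)
  have := isProbabilityMeasureBeta hpos hpos
  set μ := Measure.pi fun j => betaMeasure ((gap N j : ℝ) / 2) ((gap N j : ℝ) / 2) with hμ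
  set ν := Measure.pi fun _ : Fin m => (volume : Measure ℝ).restrict (Set.Ioo 0 1) with hν
  have hmeas := measurable_average (m := m) N
  have hμ_mem : ∀ᵐ x ∂μ, ∀ j, x j ∈ Set.Ioo (0 : ℝ) 1 :=
    ae_all_iff.2 fun j => (measurePreserving_eval _ j).quasiMeasurePreserving.ae
      (ae_betaMeasure_mem_Ioo _ _)
  have hν_mem : ∀ᵐ u ∂ν, ∀ i, u i ∈ Set.Ioo (0 : ℝ) 1 :=
    ae_all_iff.2 fun i => (measurePreserving_eval _ i).quasiMeasurePreserving.ae
      (ae_restrict_mem measurableSet_Ioo)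
  have hmem : ∀ᵐ z ∂μ.prod ν, average N z.2 z.1 ∈ Set.Icc (0 : ℝ) 1 := by
    filter_upwards [Measure.quasiMeasurePreserving_fst.ae hμ_mem,
      Measure.quasiMeasurePreserving_snd.ae hν_mem] with z h1 h2
    exact average_mem_Icc hN.monotone hN0 hNk h2 h1
  refine ⟨hmeas.aemeasurable, ?_⟩
  have := Measure.isProbabilityMeasure_map (μ := μ.prod ν) hmeas.aemeasurable
  refine measure_ext_of_integral_pow ((ae_map_iff hmeas.aemeasurable measurableSet_Icc).2 hmem) ?_
    fun M => ?_
  · filter_upwards [ae_betaMeasure_mem_Ioo _ _] with x hx using ⟨hx.1.le, hx.2.le⟩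
  · rw [integral_map hmeas.aemeasurable (by fun_prop), integral_prod _
      (Integrable.of_bound (hmeas.pow_const M).aestronglyMeasurable 1 ?_)]
    -- Both moments are compared after multiplication by the positive coefficient of `(1 - z)^(-(m +
    -- 1))`.
    · have hne := (coeff_negBinomialSeries_pos (c := (m + 1 : ℕ)) (by positivity) M).ne'
      refine mul_left_cancel₀ hne ?_
      conv_rhs => rw [show ((m + 1 : ℕ) : ℝ) = ∑ j, (gap N j : ℝ) / 2 + ∑ j, (gap N j : ℝ) / 2 by
        rw [hsum, add_halves], coeff_mul_integral_pow_betaMeasure hpos hpos]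
      rw [← integral_const_mul, ← integral_coeff_prod_geomSeries hgap]
      refine integral_congr_ae (Filter.Eventually.of_forall fun x => ?_)
      simp only [hν]
      rw [← Measure.restrict_pi_pi, ← volume_pi]
      exact setIntegral_average_pow hN.monotone hN0 hNk x M
    · filter_upwards [hmem] with z hz
      rw [Real.norm_of_nonneg (pow_nonneg hz.1 M)]
      exact pow_le_one₀ hz.1 hz.2

end RWA

theorem corollary3p1 {Ω : Type*} [MeasurableSpace Ω] (P : Measure Ω) [IsProbabilityMeasure P]
    (n k : ℕ) (hk : 2 ≤ k) (hkn : k ≤ n)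
    (N : Fin (k + 1) → ℕ) (hN : StrictMono N) (hN0 : N 0 = 0) (hNk : N (Fin.last k) = n)
    (a b : ℝ) (hab : a < b)
    (U : Fin (n - 1) → Ω → ℝ)
    (hU : ∀ i, pdf.IsUniform (U i) (Set.Ioo 0 1) P)
    (hUindep : iIndepFun U P)
    (X : Fin k → Ω → ℝ)
    (hX : ∀ j, HasLaw (X j) (RWA.betaLaw a b ((RWA.gap N j : ℝ) / 2) ((RWA.gap N j : ℝ) / 2)) P)
    (hXindep : iIndepFun X P)
    (hXU : IndepFun (fun ω j => X j ω) (fun ω i => U i ω) P) :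
    HasLaw (fun ω => RWA.average N (fun i => U i ω) (fun j => X j ω))
      (RWA.betaLaw a b (∑ j, (RWA.gap N j : ℝ) / 2) (∑ j, (RWA.gap N j : ℝ) / 2)) P := by
  have hc : b - a ≠ 0 := (sub_pos.2 hab).ne'
  have hNk' : N (Fin.last k) = n - 1 + 1 := by omega
  have hUlaw : HasLaw (fun ω i => U i ω)
      (Measure.pi fun _ => (volume : Measure ℝ).restrict (Set.Ioo 0 1)) P :=
    iIndepFun.hasLaw_pi (fun i => ⟨(hU i).aemeasurable (by simp) (by simp), by
      -- The interval has length 1, so the normalising constant of the uniform law disappears.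
      have h := hU i
      rw [pdf.IsUniform, ProbabilityTheory.cond] at h
      simpa using h⟩) hUindep
  have hBlaw : HasLaw (fun ω j => (X j ω - a) / (b - a)) _ P :=
    iIndepFun.hasLaw_pi (fun j => RWA.hasLaw_betaMeasure_of_betaLaw hab (hX j))
      (hXindep.comp (fun _ x => (x - a) / (b - a)) fun _ => by fun_prop)
  have hBU : IndepFun (fun ω j => (X j ω - a) / (b - a)) (fun ω i => U i ω) P :=
    hXU.comp (φ := fun x : Fin k → ℝ => fun j => (x j - a) / (b - a)) (ψ := id) (by fun_prop)
      measurable_id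
  have hS := HasLaw.fun_comp (RWA.hasLaw_average_prod hN hN0 hNk')
    ((indepFun_iff_hasLaw_prodMk_prod hBlaw hUlaw).1 hBU)
  have hT : HasLaw (fun x => a + (b - a) * x)
      (RWA.betaLaw a b (∑ j, (RWA.gap N j : ℝ) / 2) (∑ j, (RWA.gap N j : ℝ) / 2))
      (betaMeasure (∑ j, (RWA.gap N j : ℝ) / 2) (∑ j, (RWA.gap N j : ℝ) / 2)) :=
    ⟨by fun_prop, RWA.map_affine_betaMeasure hab _ _⟩
  convert! hT.fun_comp hS using 2 with ω
  -- The weights sum to 1, so the affine map commutes with the average.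
  rw [← RWA.average_affine hN.monotone hN0 hNk']
  congr 1
  ext j
  field_simp
  ring
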